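/- Let $\tau\in\mathbb C$ with $\operatorname{Im}\tau>0$ and $h\in\mathbb C$. Let $\mathfrak h^*=\mathbb C\varepsilon_1\oplus\mathbb C\varepsilon_2$ with the bilinear form $(\varepsilon_j,\varepsilon_k)=\tfrac12\delta_{jk}$, let $W$ be the Weyl group generated by the reflections in the roots $\pm(\varepsilon_1\pm\varepsilon_2),\pm2\varepsilon_1,\pm2\varepsilon_2$ of type $C_2$, and let $Q^\vee=\mathbb Z2\varepsilon_1+\mathbb Z2\varepsilon_2$. Let $$\theta_1(z)=\sum_{k\in\mathbb Z}e^{2\pi i\left((z+\frac12)(k+\frac12)+\frac12(k+\frac12)^2\tau\right)},\qquad \theta_2(z)=\sum_{k\in\mathbb Z}e^{2\pi i\left(z(k+\frac12)+\frac12(k+\frac12)^2\tau\right)},$$ $$\theta_3(z)=\sum_{k\in\mathbb Z}e^{2\pi i\left(zk+\frac{k^2}2\tau\right)},\qquad \theta_4(z)=\sum_{k\in\mathbb Z}e^{2\pi i\left((z+\frac12)k+\frac{k^2}2\tau\right)},$$ and, for $\mu\in\mathbb Z\varepsilon_1+\mathbb Z\varepsilon_2$, $\Theta_\mu(\lambda)=\sum_{\gamma\in\mu+Q^\vee}e^{2\pi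 i\left((\gamma,\lambda)+\frac{(\gamma,\gamma)}2\tau\right)}$. Let $Th_1^W$ be the space of holomorphic functions $f$ on $\mathfrak h^*$ with $f(\lambda+\alpha)=f(\lambda)$ and $e^{2\pi i\left((\lambda,\alpha)+\frac{(\alpha,\alpha)}2\tau\right)}f(\lambda+\tau\alpha)=f(\lambda)$ for all $\alpha\in Q^\vee$, and $f(w\lambda)=f(\lambda)$ for all $w\in W$. With $\mathcal P_1=\{\pm\varepsilon_1,\pm\varepsilon_2\}$ and $\lambda_p=(\lambda,p)$, define the difference operators $$(\widetilde M_1f)(\lambda)=\sum_{p\in\mathcal P_1}\ \prod_{q\in\mathcal P_1,\,q\ne\pm p}\frac{\theta_1(\lambda_{p+q}-h)}{\theta_1(\lambda_{p+q})}\,f(\lambda+2hp),$$ $$(\widetilde M_2f)(\lambda)=\sum_{p=\pm\varepsilon_1,\ q=\pm\varepsilon_2}\left(\frac{\theta_1(\lambda_{p+q}-h)}{\theta_1(\lambda_{p+q}+h)}f(\lambda+2hp+2hq)+\frac{\theta_1(\lambda_{p+q}-h)\theta_1(\lambda_{p+q}+2h)}{\theta_1(\lambda_{p+q})\theta_1(\lambda_{p+q}+h)}f(\lambda)\right).$$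 Put $f_1=\Theta_{\varepsilon_1}+\Theta_{\varepsilon_2}$, $f_2=\Theta_0+\Theta_{\varepsilon_1+\varepsilon_2}$, $f_3=\Theta_0-\Theta_{\varepsilon_1+\varepsilon_2}$. Then $f_1,f_2,f_3$ lie in $Th_1^W$ and are linearly independent (in particular non-zero), and for every $i\in\{1,2,3\}$ such that $\theta_1(h)\ne0$ and $\theta_{i+1}(h)\ne0$, the function $f_i$ is a common eigenfunction of $\widetilde M_1$ and $\widetilde M_2$: $$\widetilde M_df_i=E_{d,i}f_i\quad(d=1,2),\qquad E_{1,i}=\left(\frac{\theta_1(2h)\,\theta_{i+1}(0)}{\theta_1(h)\,\theta_{i+1}(h)}\right)^2,\qquad E_{2,i}=2E_{1,i},$$ the equality holding at every $\lambda$ at which no denominator in the coefficients of $\widetilde M_d$ vanishes. -/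

import Mathlib

namespace C2

/-- The dual Cartan subalgebra of `sp(4, ℂ)`: the vector `x` is `x 0 • ε₁ + x 1 • ε₂`. -/
abbrev V : Type := Fin 2 → ℂ

/-- The weight `ε₁`. -/
def e1 : V := ![1, 0]

/-- The weight `ε₂`. -/
def e2 : V := ![0, 1]

/-- The normalized Killing form: the bilinear form with `(ε_j, ε_k) = δ_{jk} / 2`. -/
noncomputable def form (x y : V) : ℂ := (x 0 * y 0 + x 1 * y 1) / 2

/-- The roots `±(ε₁ ± ε₂), ±2ε₁, ±2ε₂`. -/
def roots : Set V :=
  {e1 + e2, -(e1 + e2), e1 - e2, -(e1 - e2),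
    (2 : ℂ) • e1, -((2 : ℂ) • e1), (2 : ℂ) • e2, -((2 : ℂ) • e2)}

/-- The Weyl group: generated by the reflections `x ↦ x - (2 (x, α) / (α, α)) α`, `α` a root. -/
def weylGroup : Subgroup (V ≃ₗ[ℂ] V) :=
  Subgroup.closure {s | ∃ a ∈ roots, ∀ x : V, s x = x - (2 * form x a / form a a) • a}

/-- The coroot lattice `ℤ 2ε₁ + ℤ 2ε₂`, coroots being identified with vectors by the form. -/
def corootLattice : AddSubgroup V :=
  AddSubgroup.closure {(2 : ℂ) • e1, (2 : ℂ) • e2}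

/-- The weights `±ε₁, ±ε₂` of the first fundamental representation. -/
noncomputable def P1 : Finset V := {e1, -e1, e2, -e2}

/-- The Jacobi theta function `θ₁(z | τ)`. -/
noncomputable def theta1 (τ z : ℂ) : ℂ :=
  ∑' k : ℤ, Complex.exp (2 * Real.pi * Complex.I *
    ((z + 1 / 2) * ((k : ℂ) + 1 / 2) + 1 / 2 * ((k : ℂ) + 1 / 2) ^ 2 * τ))

/-- The Jacobi theta function `θ₂(z | τ)`. -/
noncomputable def theta2 (τ z : ℂ) : ℂ :=
  ∑' k : ℤ, Complex.exp (2 * Real.pi * Complex.I *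
    (z * ((k : ℂ) + 1 / 2) + 1 / 2 * ((k : ℂ) + 1 / 2) ^ 2 * τ))

/-- The Jacobi theta function `θ₃(z | τ)`. -/
noncomputable def theta3 (τ z : ℂ) : ℂ :=
  ∑' k : ℤ, Complex.exp (2 * Real.pi * Complex.I * (z * (k : ℂ) + (k : ℂ) ^ 2 / 2 * τ))

/-- The Jacobi theta function `θ₄(z | τ)`. -/
noncomputable def theta4 (τ z : ℂ) : ℂ :=
  ∑' k : ℤ, Complex.exp (2 * Real.pi * Complex.I *
    ((z + 1 / 2) * (k : ℂ) + (k : ℂ) ^ 2 / 2 * τ))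

/-- The triple `θ₂, θ₃, θ₄`. -/
noncomputable def evenTheta (τ : ℂ) : Fin 3 → ℂ → ℂ := ![theta2 τ, theta3 τ, theta4 τ]

/-- The classical theta function `Θ_μ`, a sum over the coset `μ + Q^∨`. -/
noncomputable def Theta (τ : ℂ) (μ : V) (x : V) : ℂ :=
  ∑' b : corootLattice, Complex.exp (2 * Real.pi * Complex.I *
    (form (μ + (b : V)) x + form (μ + (b : V)) (μ + (b : V)) / 2 * τ))

/-- The translation `(T_β f)(x) = f (x + β)`. -/
def transl (b : V) (f : V → ℂ) : V → ℂ := fun x => f (x + b)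

/-- The operator `(T_{τβ} f)(x) = exp (2πi ((x, β) + (β, β) τ / 2)) f (x + τ β)`. -/
noncomputable def translTau (τ : ℂ) (b : V) (f : V → ℂ) : V → ℂ := fun x =>
  Complex.exp (2 * Real.pi * Complex.I * (form x b + form b b / 2 * τ)) * f (x + τ • b)

/-- The space of theta functions of level one. -/
def Th1 (τ : ℂ) : Set (V → ℂ) :=
  {f | Differentiable ℂ f ∧ ∀ a ∈ corootLattice, translTau τ a f = f ∧ transl a f = f}

/-- The Weyl-invariant theta functions of level one. -/
def Th1W (τ : ℂ) : Set (V → ℂ) :=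
  {f | f ∈ Th1 τ ∧ ∀ w ∈ weylGroup, ∀ x : V, f (w x) = f x}

/-- The difference operator `M̃₁`, with step `h`. -/
noncomputable def M1 (τ h : ℂ) (f : V → ℂ) (x : V) : ℂ :=
  ∑ p ∈ P1, (∏ q ∈ P1 with q ≠ p ∧ q ≠ -p,
    theta1 τ (form x (p + q) - h) / theta1 τ (form x (p + q))) *
      transl (h • (2 : ℂ) • p) f x

/-- The difference operator `M̃₂`, with step `h`. -/
noncomputable def M2 (τ h : ℂ) (f : V → ℂ) (x : V) : ℂ :=
  ∑ p ∈ ({e1, -e1} : Finset V), ∑ q ∈ ({e2, -e2} : Finset V),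
    (theta1 τ (form x (p + q) - h) / theta1 τ (form x (p + q) + h) *
        transl (h • (2 : ℂ) • p) (transl (h • (2 : ℂ) • q) f) x +
      theta1 τ (form x (p + q) - h) * theta1 τ (form x (p + q) + 2 * h) /
        (theta1 τ (form x (p + q)) * theta1 τ (form x (p + q) + h)) * f x)

/-- The points at which no denominator of the coefficients of `M̃₁` vanishes. -/
def regular1 (τ : ℂ) : Set V :=
  {x | ∀ p ∈ P1, ∀ q ∈ P1, q ≠ p → q ≠ -p → theta1 τ (form x (p + q)) ≠ 0}

/-- The points at which no denominator of the coefficients of `M̃₂` vanishes. -/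
def regular2 (τ h : ℂ) : Set V :=
  {x | ∀ p ∈ ({e1, -e1} : Finset V), ∀ q ∈ ({e2, -e2} : Finset V),
    theta1 τ (form x (p + q)) ≠ 0 ∧ theta1 τ (form x (p + q) + h) ≠ 0}

/-- The three functions `Θ_{ε₁} + Θ_{ε₂}`, `Θ_0 + Θ_{ε₁+ε₂}`, `Θ_0 - Θ_{ε₁+ε₂}`. -/
noncomputable def eigenfun (τ : ℂ) : Fin 3 → V → ℂ :=
  ![fun x => Theta τ e1 x + Theta τ e2 x,
    fun x => Theta τ 0 x + Theta τ (e1 + e2) x,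
    fun x => Theta τ 0 x - Theta τ (e1 + e2) x]

/-- The eigenvalue `(θ₁(2h) θ_{i+1}(0) / (θ₁(h) θ_{i+1}(h)))²`. -/
noncomputable def eigenval1 (τ h : ℂ) (i : Fin 3) : ℂ :=
  (theta1 τ (2 * h) * evenTheta τ i 0 / (theta1 τ h * evenTheta τ i h)) ^ 2

/-- The eigenvalue of `M̃₂`, twice that of `M̃₁`. -/
noncomputable def eigenval2 (τ h : ℂ) (i : Fin 3) : ℂ := 2 * eigenval1 τ h i

end C2

/-!
Splitting a double series over `ℤ × ℤ` by the parity of `k - l` expresses a product of two theta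
functions of modulus `τ` through theta functions of modulus `2 τ`. These addition formulas have two
consequences. Write `u = (x, ε₁ + ε₂)` and `v = (x, ε₁ - ε₂)`. Firstly, `Θ_μ` is a product of
functions of `u + v` and `u - v`, so that `f_i` is the product `θ_{i+1}(u) θ_{i+1}(v)`. Secondly,
`θ_{i+1}` is an eigenfunction, with eigenvalue `c` say, of the difference operator `L` of rank one.
In the variables `u, v` one has `M̃₁ = L ⊗ L` and `M̃₂ = L² ⊗ 1 + 1 ⊗ L²`, so the eigenvalues of
`f_i` are `c²` and `2 c²`.

The Heisenberg group acts on the functions `Θ_μ`: translations by weights multiply them by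
characters, and translations by `τ` times weights shift `μ`. Hence they lie in `Th1`, and the `f_i`
are eigenfunctions of `T_β + 2 T_{τβ}`, `β = ε₁ + ε₂`, for the distinct eigenvalues `1, 3, -1`.
-/

namespace C2

open Complex
open scoped Real

theorem exp_two_pi_I_mul_add_int (z : ℂ) (n : ℤ) :
    cexp (2 * π * I * (z + n)) = cexp (2 * π * I * z) := by
  rw [mul_add, mul_comm _ (n : ℂ)]
  exact exp_periodic.int_mul n _

section ThetaChar

/-- The general term of the series `thetaChar`. -/
noncomputable def thetaCharTerm (τ c z : ℂ) (k : ℤ) : ℂ :=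
  cexp (2 * π * I * (z * (k + c) + (k + c) ^ 2 / 2 * τ))

/-- The theta function `ϑ[c](z | τ)` with characteristic `c`. It interpolates `θ₃` (at `c = 0`) and
`θ₂` (at `c = 1 / 2`); the second characteristic is left out, being a translation of `z`. -/
noncomputable def thetaChar (τ c z : ℂ) : ℂ := ∑' k : ℤ, thetaCharTerm τ c z k

theorem thetaCharTerm_eq (τ c z : ℂ) (k : ℤ) : thetaCharTerm τ c z k =
    cexp (2 * π * I * (z * c + c ^ 2 / 2 * τ)) * jacobiTheta₂_term k (z + c * τ) τ := by
  rw [thetaCharTerm, jacobiTheta₂_term, ← Complex.exp_add]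
  ring_nf

theorem thetaChar_eq (τ c z : ℂ) : thetaChar τ c z =
    cexp (2 * π * I * (z * c + c ^ 2 / 2 * τ)) * jacobiTheta₂ (z + c * τ) τ := by
  simp only [thetaChar, thetaCharTerm_eq, tsum_mul_left, jacobiTheta₂]

theorem thetaChar_char_add_one (τ c z : ℂ) : thetaChar τ (c + 1) z = thetaChar τ c z := by
  rw [thetaChar, thetaChar, ← (Equiv.addRight (1 : ℤ)).tsum_eq (thetaCharTerm τ c z)]
  refine tsum_congr fun k => ?_
  simp only [thetaCharTerm, Equiv.coe_addRight]
  push_cast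
  ring_nf

theorem thetaChar_neg (τ c z : ℂ) : thetaChar τ c (-z) = thetaChar τ (-c) z := by
  rw [thetaChar, thetaChar, ← (Equiv.neg ℤ).tsum_eq]
  refine tsum_congr fun k => ?_
  simp only [thetaCharTerm, Equiv.neg_apply]
  push_cast
  ring_nf

theorem thetaChar_add_one (τ c z : ℂ) :
    thetaChar τ c (z + 1) = cexp (2 * π * I * c) * thetaChar τ c z := by
  rw [thetaChar, thetaChar, ← tsum_mul_left]
  refine tsum_congr fun k => ?_
  rw [thetaCharTerm, thetaCharTerm, ← Complex.exp_add, ← mul_add,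
    ← exp_two_pi_I_mul_add_int (c + _) k]
  ring_nf

variable {τ : ℂ}

theorem differentiable_thetaChar (hτ : 0 < τ.im) (c : ℂ) : Differentiable ℂ (thetaChar τ c) := by
  have hJ : Differentiable ℂ fun z => jacobiTheta₂ z τ :=
    fun z => differentiableAt_jacobiTheta₂_fst z hτ
  rw [funext (thetaChar_eq τ c)]
  exact Differentiable.mul (by fun_prop) (hJ.comp (differentiable_id.add_const _))

theorem summable_norm_thetaCharTerm (hτ : 0 < τ.im) (c z : ℂ) :
    Summable fun k => ‖thetaCharTerm τ c z k‖ := by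
  simp only [thetaCharTerm_eq]
  exact (((summable_jacobiTheta₂_term_iff _ τ).mpr hτ).mul_left _).norm

theorem hasSum_thetaChar_mul {τ' : ℂ} (hτ : 0 < τ.im) (hτ' : 0 < τ'.im) (c d x y : ℂ) :
    HasSum (fun p : ℤ × ℤ => thetaCharTerm τ c x p.1 * thetaCharTerm τ' d y p.2)
      (thetaChar τ c x * thetaChar τ' d y) := by
  have hx := summable_norm_thetaCharTerm hτ c x
  have hy := summable_norm_thetaCharTerm hτ' d y
  exact hx.of_norm.hasSum.mul hy.of_norm.hasSum (summable_mul_of_summable_norm hx hy)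

theorem two_mul_im_pos (hτ : 0 < τ.im) : 0 < (2 * τ).im := by
  simpa using hτ

/-- The pairs of integers of equal parity `(k + l, k - l)` and of opposite parity
`(k + l + 1, k - l)`. It splits the double series of a product of two theta functions. -/
def parityEquiv : (ℤ × ℤ) ⊕ (ℤ × ℤ) ≃ ℤ × ℤ where
  toFun := Sum.elim (fun p => (p.1 + p.2, p.1 - p.2)) (fun p => (p.1 + p.2 + 1, p.1 - p.2))
  invFun p := if (p.1 + p.2) % 2 = 0 then Sum.inl ((p.1 + p.2) / 2, (p.1 - p.2) / 2)
    else Sum.inr ((p.1 + p.2) / 2, (p.1 - p.2) / 2)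
  left_inv := by grind
  right_inv := by grind

theorem thetaChar_mul_thetaChar (hτ : 0 < τ.im) (c d x y : ℂ) :
    thetaChar τ c x * thetaChar τ d y =
      thetaChar (2 * τ) ((c + d) / 2) (x + y) * thetaChar (2 * τ) ((c - d) / 2) (x - y) +
      thetaChar (2 * τ) ((c + d) / 2 + 1 / 2) (x + y) *
        thetaChar (2 * τ) ((c - d) / 2 + 1 / 2) (x - y) := by
  have h2 := two_mul_im_pos hτ
  refine ((parityEquiv.hasSum_iff).mpr (hasSum_thetaChar_mul hτ hτ c d x y)).unique
    (HasSum.sum ?_ ?_)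
  · convert hasSum_thetaChar_mul h2 h2 ((c + d) / 2) ((c - d) / 2) (x + y) (x - y) using 2 with p
    simp only [parityEquiv, Function.comp_apply, Equiv.coe_fn_mk, Sum.elim_inl, thetaCharTerm,
      ← Complex.exp_add]
    push_cast
    ring_nf
  · convert hasSum_thetaChar_mul h2 h2 ((c + d) / 2 + 1 / 2) ((c - d) / 2 + 1 / 2) (x + y) (x - y)
      using 2 with p
    simp only [parityEquiv, Function.comp_apply, Equiv.coe_fn_mk, Sum.elim_inr, thetaCharTerm,
      ← Complex.exp_add]
    push_cast
    ring_nf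

theorem integral_jacobiTheta₂_term (n : ℤ) (τ : ℂ) :
    ∫ t : ℝ in 0..1, jacobiTheta₂_term n t τ = if n = 0 then 1 else 0 := by
  split_ifs with hn
  · simp [hn, jacobiTheta₂_term]
  · have hn' : 2 * π * I * n ≠ 0 := mul_ne_zero two_pi_I_ne_zero (Int.cast_ne_zero.mpr hn)
    simp only [jacobiTheta₂_term, Complex.exp_add]
    rw [intervalIntegral.integral_mul_const, integral_exp_mul_complex hn', ofReal_one, mul_one,
      mul_comm _ (n : ℂ), exp_int_mul_two_pi_mul_I]
    simp

theorem integral_jacobiTheta₂ (hτ : 0 < τ.im) : ∫ t : ℝ in 0..1, jacobiTheta₂ t τ = 1 := by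
  have hcont (n : ℤ) : Continuous fun t : ℝ => jacobiTheta₂_term n t τ := by
    unfold jacobiTheta₂_term
    fun_prop
  have hs := intervalIntegral.hasSum_integral_of_dominated_convergence (a := 0) (b := 1)
    (μ := MeasureTheory.volume) (F := fun (n : ℤ) (t : ℝ) => jacobiTheta₂_term n t τ)
    (f := fun t : ℝ => jacobiTheta₂ t τ) (fun n _ => ‖jacobiTheta₂_term n 0 τ‖)
    (fun n => (hcont n).aestronglyMeasurable)
    (fun n => .of_forall fun t _ => by simp [norm_jacobiTheta₂_term])
    (.of_forall fun t _ => ((summable_jacobiTheta₂_term_iff 0 τ).mpr hτ).norm)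
    intervalIntegrable_const
    (.of_forall fun t _ => hasSum_jacobiTheta₂_term t hτ)
  simp only [integral_jacobiTheta₂_term] at hs
  exact hs.unique (hasSum_ite_eq 0 1)

theorem exists_thetaChar_ne_zero (hτ : 0 < τ.im) (c : ℂ) : ∃ z, thetaChar τ c z ≠ 0 := by
  obtain ⟨t, ht⟩ : ∃ t : ℝ, jacobiTheta₂ t τ ≠ 0 := by
    by_contra! h
    simpa [h] using integral_jacobiTheta₂ hτ
  refine ⟨t - c * τ, ?_⟩
  rw [thetaChar_eq, sub_add_cancel]
  exact mul_ne_zero (Complex.exp_ne_zero _) ht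

end ThetaChar

section JacobiTheta

theorem theta2_eq_thetaChar (τ : ℂ) : theta2 τ = thetaChar τ (1 / 2) := by
  funext z
  refine tsum_congr fun k => ?_
  rw [thetaCharTerm]
  ring_nf

theorem theta3_eq_thetaChar (τ : ℂ) : theta3 τ = thetaChar τ 0 := by
  funext z
  refine tsum_congr fun k => ?_
  rw [thetaCharTerm, add_zero]

theorem theta1_eq_theta2 (τ z : ℂ) : theta1 τ z = theta2 τ (z + 1 / 2) := rfl

theorem theta4_eq_theta3 (τ z : ℂ) : theta4 τ z = theta3 τ (z + 1 / 2) := rfl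

theorem theta2_neg (τ z : ℂ) : theta2 τ (-z) = theta2 τ z := by
  rw [theta2_eq_thetaChar, thetaChar_neg, ← thetaChar_char_add_one]
  norm_num

theorem theta3_neg (τ z : ℂ) : theta3 τ (-z) = theta3 τ z := by
  rw [theta3_eq_thetaChar, thetaChar_neg, neg_zero]

theorem theta2_add_one (τ z : ℂ) : theta2 τ (z + 1) = -theta2 τ z := by
  rw [theta2_eq_thetaChar, thetaChar_add_one, show 2 * π * I * (1 / 2) = π * I by ring,
    exp_pi_mul_I, neg_one_mul]

theorem theta3_add_one (τ z : ℂ) : theta3 τ (z + 1) = theta3 τ z := by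
  rw [theta3_eq_thetaChar, thetaChar_add_one, mul_zero, Complex.exp_zero, one_mul]

theorem theta1_neg (τ z : ℂ) : theta1 τ (-z) = -theta1 τ z := by
  rw [theta1_eq_theta2, theta1_eq_theta2, show z + 1 / 2 = z - 1 / 2 + 1 by ring, theta2_add_one,
    neg_neg, ← theta2_neg]
  ring_nf

theorem theta4_neg (τ z : ℂ) : theta4 τ (-z) = theta4 τ z := by
  rw [theta4_eq_theta3, theta4_eq_theta3, ← theta3_neg, ← theta3_add_one]
  ring_nf

theorem evenTheta_neg (τ : ℂ) (i : Fin 3) (z : ℂ) : evenTheta τ i (-z) = evenTheta τ i z := by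
  fin_cases i
  exacts [theta2_neg τ z, theta3_neg τ z, theta4_neg τ z]

variable {τ : ℂ}

theorem exists_evenTheta_ne_zero (hτ : 0 < τ.im) (i : Fin 3) : ∃ z, evenTheta τ i z ≠ 0 := by
  obtain ⟨z₂, h₂⟩ := exists_thetaChar_ne_zero hτ (1 / 2)
  obtain ⟨z₃, h₃⟩ := exists_thetaChar_ne_zero hτ 0
  rw [← theta2_eq_thetaChar] at h₂
  rw [← theta3_eq_thetaChar] at h₃
  fin_cases i
  · exact ⟨z₂, h₂⟩
  · exact ⟨z₃, h₃⟩
  · refine ⟨z₃ - 1 / 2, ?_⟩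
    change theta4 τ (z₃ - 1 / 2) ≠ 0
    rwa [theta4_eq_theta3, sub_add_cancel]

theorem theta2_mul_theta2 (hτ : 0 < τ.im) (x y : ℂ) :
    theta2 τ x * theta2 τ y = theta2 (2 * τ) (x + y) * theta3 (2 * τ) (x - y) +
      theta3 (2 * τ) (x + y) * theta2 (2 * τ) (x - y) := by
  simp only [theta2_eq_thetaChar, theta3_eq_thetaChar]
  rw [thetaChar_mul_thetaChar hτ, ← thetaChar_char_add_one _ 0 (x + y)]
  norm_num

theorem theta3_mul_theta3 (hτ : 0 < τ.im) (x y : ℂ) :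
    theta3 τ x * theta3 τ y = theta3 (2 * τ) (x + y) * theta3 (2 * τ) (x - y) +
      theta2 (2 * τ) (x + y) * theta2 (2 * τ) (x - y) := by
  simp only [theta2_eq_thetaChar, theta3_eq_thetaChar]
  rw [thetaChar_mul_thetaChar hτ]
  norm_num

theorem theta1_mul_theta1 (hτ : 0 < τ.im) (x y : ℂ) :
    theta1 τ x * theta1 τ y = theta3 (2 * τ) (x + y) * theta2 (2 * τ) (x - y) -
      theta2 (2 * τ) (x + y) * theta3 (2 * τ) (x - y) := by
  rw [theta1_eq_theta2, theta1_eq_theta2, theta2_mul_theta2 hτ, add_sub_add_right_eq_sub,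
    add_add_add_comm, add_halves, theta2_add_one, theta3_add_one]
  ring

theorem theta4_mul_theta4 (hτ : 0 < τ.im) (x y : ℂ) :
    theta4 τ x * theta4 τ y = theta3 (2 * τ) (x + y) * theta3 (2 * τ) (x - y) -
      theta2 (2 * τ) (x + y) * theta2 (2 * τ) (x - y) := by
  rw [theta4_eq_theta3, theta4_eq_theta3, theta3_mul_theta3 hτ, add_sub_add_right_eq_sub,
    add_add_add_comm, add_halves, theta2_add_one, theta3_add_one]
  ring

theorem theta1_evenTheta_difference_equation (hτ : 0 < τ.im) (i : Fin 3) (h u : ℂ) :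
    theta1 τ h * evenTheta τ i h *
        (theta1 τ (u - h) * evenTheta τ i (u + h) + theta1 τ (u + h) * evenTheta τ i (u - h)) =
      theta1 τ (2 * h) * evenTheta τ i 0 * (theta1 τ u * evenTheta τ i u) := by
  -- After this regrouping every product has its arguments `x ± y` among `u`, `u + 2h`, `u - 2h`.
  suffices
      (theta1 τ (u - h) * theta1 τ h) * (evenTheta τ i (u + h) * evenTheta τ i h) +
        (theta1 τ (u + h) * theta1 τ h) * (evenTheta τ i (u - h) * evenTheta τ i h) =
      (theta1 τ u * theta1 τ (2 * h)) * (evenTheta τ i u * evenTheta τ i 0) by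
    linear_combination this
  have hadd : u + h + h = u + 2 * h := by ring
  have hsub : u - h - h = u - 2 * h := by ring
  fin_cases i
  · change _ * (theta2 τ _ * theta2 τ _) + _ * (theta2 τ _ * theta2 τ _) =
      _ * (theta2 τ _ * theta2 τ _)
    simp only [theta1_mul_theta1 hτ, theta2_mul_theta2 hτ, sub_add_cancel, add_sub_cancel_right,
      hadd, hsub, add_zero, sub_zero]
    ring
  · change _ * (theta3 τ _ * theta3 τ _) + _ * (theta3 τ _ * theta3 τ _) =
      _ * (theta3 τ _ * theta3 τ _)
    simp only [theta1_mul_theta1 hτ, theta3_mul_theta3 hτ, sub_add_cancel, add_sub_cancel_right,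
      hadd, hsub, add_zero, sub_zero]
    ring
  · change _ * (theta4 τ _ * theta4 τ _) + _ * (theta4 τ _ * theta4 τ _) =
      _ * (theta4 τ _ * theta4 τ _)
    simp only [theta1_mul_theta1 hτ, theta4_mul_theta4 hτ, sub_add_cancel, add_sub_cancel_right,
      hadd, hsub, add_zero, sub_zero]
    ring

end JacobiTheta

section RankOne

/-- The difference operator of type `A₁` with step `h`. In the coordinates `(x, ε₁ + ε₂)` and
`(x, ε₁ - ε₂)`, both `M̃₁` and `M̃₂` are built from it. -/
noncomputable def rankOneOp (τ h : ℂ) (g : ℂ → ℂ) (u : ℂ) : ℂ :=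
  theta1 τ (u - h) / theta1 τ u * g (u + h) + theta1 τ (u + h) / theta1 τ u * g (u - h)

/-- The eigenvalue of `rankOneOp` on `θ_{i+1}`, whose square is `eigenval1`. -/
noncomputable def rankOneEigenval (τ h : ℂ) (i : Fin 3) : ℂ :=
  theta1 τ (2 * h) * evenTheta τ i 0 / (theta1 τ h * evenTheta τ i h)

variable {τ h u : ℂ} {i : Fin 3}

theorem rankOneOp_rankOneOp (g : ℂ → ℂ) (hu : theta1 τ u ≠ 0) :
    rankOneOp τ h (rankOneOp τ h g) u =
      theta1 τ (u - h) / theta1 τ (u + h) * g (u + 2 * h) +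
        theta1 τ (u - h) * theta1 τ (u + 2 * h) / (theta1 τ u * theta1 τ (u + h)) * g u +
      (theta1 τ (u + h) / theta1 τ (u - h) * g (u - 2 * h) +
        theta1 τ (u + h) * theta1 τ (u - 2 * h) / (theta1 τ u * theta1 τ (u - h)) * g u) := by
  have hadd : u + h + h = u + 2 * h := by ring
  have hsub : u - h - h = u - 2 * h := by ring
  simp only [rankOneOp, add_sub_cancel_right, sub_add_cancel, hadd, hsub]
  field_simp
  ring

theorem rankOneOp_evenTheta (hτ : 0 < τ.im) (h₁ : theta1 τ h ≠ 0) (hi : evenTheta τ i h ≠ 0)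
    (hu : theta1 τ u ≠ 0) :
    rankOneOp τ h (evenTheta τ i) u = rankOneEigenval τ h i * evenTheta τ i u := by
  rw [rankOneOp, rankOneEigenval, div_mul_eq_mul_div, div_mul_eq_mul_div, ← add_div,
    div_mul_eq_mul_div, div_eq_div_iff hu (mul_ne_zero h₁ hi)]
  linear_combination theta1_evenTheta_difference_equation hτ i h u

theorem rankOneOp_rankOneOp_evenTheta (hτ : 0 < τ.im) (h₁ : theta1 τ h ≠ 0)
    (hi : evenTheta τ i h ≠ 0) (hu : theta1 τ u ≠ 0) (hadd : theta1 τ (u + h) ≠ 0)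
    (hsub : theta1 τ (u - h) ≠ 0) :
    rankOneOp τ h (rankOneOp τ h (evenTheta τ i)) u =
      rankOneEigenval τ h i ^ 2 * evenTheta τ i u := by
  rw [rankOneOp, rankOneOp_evenTheta hτ h₁ hi hadd, rankOneOp_evenTheta hτ h₁ hi hsub, sq,
    mul_assoc, ← rankOneOp_evenTheta hτ h₁ hi hu, rankOneOp]
  ring

end RankOne

section Form

theorem form_comm (x y : V) : form x y = form y x := by
  simp only [form, mul_comm]

theorem form_add_left (x y z : V) : form (x + y) z = form x z + form y z := by
  simp only [form, Pi.add_apply]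
  ring

theorem form_smul_left (c : ℂ) (x y : V) : form (c • x) y = c * form x y := by
  simp only [form, Pi.smul_apply, smul_eq_mul]
  ring

theorem form_neg_left (x y : V) : form (-x) y = -form x y := by
  rw [← neg_one_smul ℂ, form_smul_left, neg_one_mul]

theorem form_neg_right (x y : V) : form x (-y) = -form x y := by
  rw [form_comm, form_neg_left, form_comm]

theorem form_e1_add_e2 (x : V) : form x (e1 + e2) = (x 0 + x 1) / 2 := by
  simp [form, e1, e2]

theorem form_e1_sub_e2 (x : V) : form x (e1 - e2) = (x 0 - x 1) / 2 := by
  simp [form, e1, e2, sub_eq_add_neg]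

theorem form_neg_e1_add_e2 (x : V) : form x (-e1 + e2) = -form x (e1 - e2) := by
  rw [← form_neg_right, neg_sub, neg_add_eq_sub]

theorem form_neg_e1_add_neg_e2 (x : V) : form x (-e1 + -e2) = -form x (e1 + e2) := by
  rw [← form_neg_right, neg_add]

end Form

section Lattices

/-- The lattice `ℤ ε₁ + ℤ ε₂` of the weights `μ` that index the functions `Θ_μ`. -/
def weightLattice : AddSubgroup V := AddSubgroup.closure {e1, e2}

theorem e1_mem_weightLattice : e1 ∈ weightLattice := AddSubgroup.subset_closure (.inl rfl)

theorem e2_mem_weightLattice : e2 ∈ weightLattice := AddSubgroup.subset_closure (.inr rfl)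

theorem two_smul_e1_mem_corootLattice : (2 : ℂ) • e1 ∈ corootLattice :=
  AddSubgroup.subset_closure (.inl rfl)

theorem two_smul_e2_mem_corootLattice : (2 : ℂ) • e2 ∈ corootLattice :=
  AddSubgroup.subset_closure (.inr rfl)

theorem corootLattice_le_weightLattice : corootLattice ≤ weightLattice := by
  refine (AddSubgroup.closure_le _).mpr ?_
  rintro _ (rfl | rfl)
  · rw [two_smul]
    exact add_mem e1_mem_weightLattice e1_mem_weightLattice
  · rw [two_smul]
    exact add_mem e2_mem_weightLattice e2_mem_weightLattice

theorem mem_corootLattice_iff {b : V} :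
    b ∈ corootLattice ↔ ∃ m n : ℤ, ![2 * (m : ℂ), 2 * (n : ℂ)] = b := by
  rw [corootLattice, AddSubgroup.mem_closure_pair]
  refine exists₂_congr fun m n => Eq.congr_left ?_
  ext j
  fin_cases j <;> simp [e1, e2, mul_comm]

theorem exists_int_form_eq {b μ : V} (hb : b ∈ corootLattice) (hμ : μ ∈ weightLattice) :
    ∃ n : ℤ, form b μ = n := by
  obtain ⟨k, l, rfl⟩ := mem_corootLattice_iff.mp hb
  obtain ⟨m, n, rfl⟩ := AddSubgroup.mem_closure_pair.mp hμ
  refine ⟨k * m + l * n, ?_⟩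
  simp only [form, e1, e2, Matrix.smul_cons, zsmul_eq_mul, mul_one, smul_zero, Matrix.smul_empty,
    Pi.add_apply, Matrix.cons_val_zero, Matrix.cons_val_one, Int.cast_add, Int.cast_mul]
  ring

/-- Coordinates on the coroot lattice. -/
noncomputable def corootEquiv : ℤ × ℤ ≃ corootLattice :=
  Equiv.ofBijective
    (fun p => ⟨![2 * (p.1 : ℂ), 2 * (p.2 : ℂ)], mem_corootLattice_iff.mpr ⟨p.1, p.2, rfl⟩⟩)
    ⟨fun p q h => by
      have h0 := congrFun (Subtype.ext_iff.mp h) 0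
      have h1 := congrFun (Subtype.ext_iff.mp h) 1
      simpa [Prod.ext_iff] using And.intro h0 h1,
    fun b => by
      obtain ⟨m, n, h⟩ := mem_corootLattice_iff.mp b.2
      exact ⟨(m, n), Subtype.ext h⟩⟩

theorem coe_corootEquiv (p : ℤ × ℤ) :
    (corootEquiv p : V) = ![2 * (p.1 : ℂ), 2 * (p.2 : ℂ)] := rfl

end Lattices

section ClassicalTheta

variable {τ : ℂ}

theorem translTau_Theta (τ : ℂ) (β μ : V) :
    translTau τ β (Theta τ μ) = Theta τ (μ + β) := by
  funext x
  rw [translTau, Theta, Theta, ← tsum_mul_left]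
  refine tsum_congr fun b => ?_
  rw [← Complex.exp_add]
  simp only [form, Pi.add_apply, Pi.smul_apply, smul_eq_mul]
  ring_nf

theorem Theta_add_of_mem_corootLattice (τ : ℂ) (μ : V) {b : V} (hb : b ∈ corootLattice) :
    Theta τ (μ + b) = Theta τ μ := by
  funext x
  rw [Theta, Theta, ← (Equiv.addLeft (⟨b, hb⟩ : corootLattice)).tsum_eq
    fun c => cexp (2 * π * I * (form (μ + c) x + form (μ + c) (μ + c) / 2 * τ))]
  exact tsum_congr fun c => by rw [Equiv.coe_addLeft, AddSubgroup.coe_add, add_assoc]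

theorem transl_Theta (τ : ℂ) (μ : V) {β : V} (hβ : β ∈ weightLattice) :
    transl β (Theta τ μ) = cexp (2 * π * I * form μ β) • Theta τ μ := by
  funext x
  rw [transl, Pi.smul_apply, smul_eq_mul, Theta, Theta, ← tsum_mul_left]
  refine tsum_congr fun b => ?_
  obtain ⟨n, hn⟩ := exists_int_form_eq b.2 hβ
  have hform : form (μ + b) (x + β) = form (μ + b) x + form μ β + n := by
    rw [form_comm, form_add_left, form_comm x, form_comm β, form_add_left μ b β, hn]
    ring
  rw [hform, ← Complex.exp_add, ← mul_add,
    ← exp_two_pi_I_mul_add_int (form μ β + (form (μ + b) x + form (μ + b) (μ + b) / 2 * τ)) n]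
  ring_nf

theorem Theta_eq_thetaChar_mul_thetaChar (hτ : 0 < τ.im) (μ x : V) :
    Theta τ μ x = thetaChar (2 * τ) (μ 0 / 2) (x 0) * thetaChar (2 * τ) (μ 1 / 2) (x 1) := by
  have h2 := two_mul_im_pos hτ
  rw [← (hasSum_thetaChar_mul h2 h2 _ _ _ _).tsum_eq, Theta, ← corootEquiv.tsum_eq]
  refine tsum_congr fun p => ?_
  simp only [coe_corootEquiv, form, thetaCharTerm, ← Complex.exp_add, Pi.add_apply,
    Matrix.cons_val_zero, Matrix.cons_val_one]
  ring_nf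

theorem differentiable_Theta (hτ : 0 < τ.im) (μ : V) : Differentiable ℂ (Theta τ μ) := by
  have hd := differentiable_thetaChar (two_mul_im_pos hτ)
  rw [funext (Theta_eq_thetaChar_mul_thetaChar hτ μ)]
  exact ((hd _).comp (differentiable_apply 0)).mul ((hd _).comp (differentiable_apply 1))

theorem Theta_mem_Th1 (hτ : 0 < τ.im) {μ : V} (hμ : μ ∈ weightLattice) : Theta τ μ ∈ Th1 τ := by
  refine ⟨differentiable_Theta hτ μ, fun a ha => ⟨?_, ?_⟩⟩
  · rw [translTau_Theta, Theta_add_of_mem_corootLattice τ μ ha]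
  · obtain ⟨n, hn⟩ := exists_int_form_eq ha hμ
    rw [transl_Theta τ μ (corootLattice_le_weightLattice ha), form_comm, hn, mul_comm,
      exp_int_mul_two_pi_mul_I, one_smul]

/-- The translation `transl b` as a linear operator on functions. -/
def translEnd (b : V) : Module.End ℂ (V → ℂ) := LinearMap.funLeft ℂ ℂ (· + b)

/-- The translation `translTau τ b` as a linear operator on functions. -/
noncomputable def translTauEnd (τ : ℂ) (b : V) : Module.End ℂ (V → ℂ) where
  toFun := translTau τ b
  map_add' f g := funext fun _ => mul_add _ (f _) (g _)
  map_smul' c f := funext fun _ => mul_left_comm _ c (f _)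

/-- The space `Th1 τ` as a submodule of the functions on `V`. -/
noncomputable def th1Submodule (τ : ℂ) : Submodule ℂ (V → ℂ) where
  carrier := Th1 τ
  zero_mem' := ⟨differentiable_const 0, fun a _ => ⟨(translTauEnd τ a).map_zero, rfl⟩⟩
  add_mem' {f g} hf hg := ⟨hf.1.add hg.1, fun a ha =>
    ⟨((translTauEnd τ a).map_add f g).trans (congrArg₂ (· + ·) (hf.2 a ha).1 (hg.2 a ha).1),
      congrArg₂ (· + ·) (hf.2 a ha).2 (hg.2 a ha).2⟩⟩
  smul_mem' c f hf := ⟨hf.1.const_smul c, fun a ha =>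
    ⟨((translTauEnd τ a).map_smul c f).trans (congrArg (c • ·) (hf.2 a ha).1),
      congrArg (c • ·) (hf.2 a ha).2⟩⟩

theorem eigenfun_mem_Th1 (hτ : 0 < τ.im) (i : Fin 3) : eigenfun τ i ∈ Th1 τ := by
  have h₀ := Theta_mem_Th1 hτ weightLattice.zero_mem
  have h₁ := Theta_mem_Th1 hτ e1_mem_weightLattice
  have h₂ := Theta_mem_Th1 hτ e2_mem_weightLattice
  have h₁₂ := Theta_mem_Th1 hτ (add_mem e1_mem_weightLattice e2_mem_weightLattice)
  fin_cases i
  exacts [(th1Submodule τ).add_mem h₁ h₂, (th1Submodule τ).add_mem h₀ h₁₂,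
    (th1Submodule τ).sub_mem h₀ h₁₂]

end ClassicalTheta

section Separation

/-- The function `g ⊗ k` in the coordinates `(x, ε₁ + ε₂)` and `(x, ε₁ - ε₂)`, which separate the
variables of `M̃₁` and `M̃₂`. -/
noncomputable def tensor (g k : ℂ → ℂ) (x : V) : ℂ :=
  g (form x (e1 + e2)) * k (form x (e1 - e2))

theorem tensor_apply (g k : ℂ → ℂ) (x : V) :
    tensor g k x = g ((x 0 + x 1) / 2) * k ((x 0 - x 1) / 2) := by
  rw [tensor, form_e1_add_e2, form_e1_sub_e2]

theorem eigenfun_eq_tensor {τ : ℂ} (hτ : 0 < τ.im) (i : Fin 3) :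
    eigenfun τ i = tensor (evenTheta τ i) (evenTheta τ i) := by
  funext x
  have hadd : form x (e1 + e2) + form x (e1 - e2) = x 0 := by
    rw [form_e1_add_e2, form_e1_sub_e2]
    ring
  have hsub : form x (e1 + e2) - form x (e1 - e2) = x 1 := by
    rw [form_e1_add_e2, form_e1_sub_e2]
    ring
  have hΘ := Theta_eq_thetaChar_mul_thetaChar hτ
  fin_cases i
  · change Theta τ e1 x + Theta τ e2 x = theta2 τ _ * theta2 τ _
    rw [theta2_mul_theta2 hτ, hadd, hsub]
    simp [hΘ, theta2_eq_thetaChar, theta3_eq_thetaChar, e1, e2]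
  · change Theta τ 0 x + Theta τ (e1 + e2) x = theta3 τ _ * theta3 τ _
    rw [theta3_mul_theta3 hτ, hadd, hsub]
    simp [hΘ, theta2_eq_thetaChar, theta3_eq_thetaChar, e1, e2]
  · change Theta τ 0 x - Theta τ (e1 + e2) x = theta4 τ _ * theta4 τ _
    rw [theta4_mul_theta4 hτ, hadd, hsub]
    simp [hΘ, theta2_eq_thetaChar, theta3_eq_thetaChar, e1, e2]

theorem transl_tensor (b : V) (g k : ℂ → ℂ) (x : V) : transl b (tensor g k) x =
    g (form x (e1 + e2) + form b (e1 + e2)) * k (form x (e1 - e2) + form b (e1 - e2)) := by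
  simp only [transl, tensor, form_add_left]

end Separation

section WeylGroup

variable {τ : ℂ}

/-- The reflection in the hyperplane orthogonal to a non-isotropic vector `a`. -/
noncomputable def reflection (a x : V) : V := x - (2 * form x a / form a a) • a

theorem reflection_neg (a x : V) : reflection (-a) x = reflection a x := by
  simp only [reflection, form_neg_right, form_neg_left, smul_neg, ← neg_smul, neg_neg, mul_neg,
    neg_div]

theorem reflection_e1_add_e2 (x : V) : reflection (e1 + e2) x = ![-x 1, -x 0] := by
  have hcoef : 2 * form x (e1 + e2) / form (e1 + e2) (e1 + e2) = x 0 + x 1 := by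
    have hself : form (e1 + e2) (e1 + e2) = 1 := by norm_num [form, e1, e2]
    rw [hself, form_e1_add_e2]
    ring
  rw [reflection, hcoef]
  ext j
  fin_cases j
  · change x 0 - (x 0 + x 1) * (1 + 0) = -x 1
    ring
  · change x 1 - (x 0 + x 1) * (0 + 1) = -x 0
    ring

theorem reflection_e1_sub_e2 (x : V) : reflection (e1 - e2) x = ![x 1, x 0] := by
  have hcoef : 2 * form x (e1 - e2) / form (e1 - e2) (e1 - e2) = x 0 - x 1 := by
    have hself : form (e1 - e2) (e1 - e2) = 1 := by norm_num [form, e1, e2]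
    rw [hself, form_e1_sub_e2]
    ring
  rw [reflection, hcoef]
  ext j
  fin_cases j
  · change x 0 - (x 0 - x 1) * (1 - 0) = x 1
    ring
  · change x 1 - (x 0 - x 1) * (0 - 1) = x 0
    ring

theorem reflection_two_smul_e1 (x : V) : reflection ((2 : ℂ) • e1) x = ![-x 0, x 1] := by
  have hcoef : 2 * form x ((2 : ℂ) • e1) / form ((2 : ℂ) • e1) ((2 : ℂ) • e1) = x 0 := by
    simp [form, e1]
  rw [reflection, hcoef]
  ext j
  fin_cases j
  · change x 0 - x 0 * (2 * 1) = -x 0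
    ring
  · change x 1 - x 0 * (2 * 0) = x 1
    ring

theorem reflection_two_smul_e2 (x : V) : reflection ((2 : ℂ) • e2) x = ![x 0, -x 1] := by
  have hcoef : 2 * form x ((2 : ℂ) • e2) / form ((2 : ℂ) • e2) ((2 : ℂ) • e2) = x 1 := by
    simp [form, e2]
  rw [reflection, hcoef]
  ext j
  fin_cases j
  · change x 0 - x 1 * (2 * 0) = x 0
    ring
  · change x 1 - x 1 * (2 * 1) = -x 1
    ring

theorem tensor_reflection {g : ℂ → ℂ} (hg : ∀ z, g (-z) = g z) {a : V} (ha : a ∈ roots) (x : V) :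
    tensor g g (reflection a x) = tensor g g x := by
  have hadd : tensor g g ![-x 1, -x 0] = tensor g g x := by
    simp only [tensor_apply, Matrix.cons_val_zero, Matrix.cons_val_one]
    rw [← hg ((x 0 + x 1) / 2)]
    ring_nf
  have hsub : tensor g g ![x 1, x 0] = tensor g g x := by
    simp only [tensor_apply, Matrix.cons_val_zero, Matrix.cons_val_one]
    rw [← hg ((x 0 - x 1) / 2)]
    ring_nf
  have h₁ : tensor g g ![-x 0, x 1] = tensor g g x := by
    simp only [tensor_apply, Matrix.cons_val_zero, Matrix.cons_val_one]
    rw [← hg ((x 0 + x 1) / 2), ← hg ((x 0 - x 1) / 2)]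
    ring_nf
  have h₂ : tensor g g ![x 0, -x 1] = tensor g g x := by
    simp only [tensor_apply, Matrix.cons_val_zero, Matrix.cons_val_one]
    ring_nf
  rcases ha with rfl | rfl | rfl | rfl | rfl | rfl | rfl | rfl
  all_goals simpa only [reflection_neg, reflection_e1_add_e2, reflection_e1_sub_e2,
    reflection_two_smul_e1, reflection_two_smul_e2]

theorem apply_eq_of_mem_weylGroup {f : V → ℂ} (hf : ∀ a ∈ roots, ∀ x, f (reflection a x) = f x)
    {w : V ≃ₗ[ℂ] V} (hw : w ∈ weylGroup) (x : V) : f (w x) = f x := by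
  induction hw using Subgroup.closure_induction generalizing x with
  | mem s hs =>
    obtain ⟨a, ha, hs⟩ := hs
    rw [hs]
    exact hf a ha x
  | one => rfl
  | mul s t _ _ hs ht => exact (hs (t x)).trans (ht x)
  | inv s _ hs => exact (hs (s⁻¹ x)).symm.trans (congrArg f (s.apply_symm_apply x))

theorem eigenfun_mem_Th1W (hτ : 0 < τ.im) (i : Fin 3) : eigenfun τ i ∈ Th1W τ := by
  refine ⟨eigenfun_mem_Th1 hτ i, fun w hw => apply_eq_of_mem_weylGroup (fun a ha x => ?_) hw⟩
  rw [eigenfun_eq_tensor hτ, tensor_reflection (evenTheta_neg τ i) ha]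

end WeylGroup

section LinearIndependence

variable {τ : ℂ}

theorem eigenfun_ne_zero (hτ : 0 < τ.im) (i : Fin 3) : eigenfun τ i ≠ 0 := by
  obtain ⟨z, hz⟩ := exists_evenTheta_ne_zero hτ i
  have hx : eigenfun τ i ((2 * z) • e1) = evenTheta τ i z * evenTheta τ i z := by
    rw [eigenfun_eq_tensor hτ, tensor, form_e1_add_e2, form_e1_sub_e2]
    simp [e1]
  exact fun h => mul_ne_zero hz hz (hx.symm.trans (congrFun h _))

theorem transl_Theta_e1_add_e2 (τ : ℂ) (μ : V) :
    transl (e1 + e2) (Theta τ μ) = cexp (π * I * (μ 0 + μ 1)) • Theta τ μ := by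
  rw [transl_Theta τ μ (add_mem e1_mem_weightLattice e2_mem_weightLattice), form_e1_add_e2]
  ring_nf

theorem translEnd_eigenfun (τ : ℂ) (i : Fin 3) :
    translEnd (e1 + e2) (eigenfun τ i) = (![-1, 1, 1] i : ℂ) • eigenfun τ i := by
  have h₀ : translEnd (e1 + e2) (Theta τ 0) = Theta τ 0 := by
    refine (transl_Theta_e1_add_e2 τ 0).trans ?_
    simp
  have h₁ : translEnd (e1 + e2) (Theta τ e1) = -Theta τ e1 := by
    refine (transl_Theta_e1_add_e2 τ e1).trans ?_
    simp [e1]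
  have h₂ : translEnd (e1 + e2) (Theta τ e2) = -Theta τ e2 := by
    refine (transl_Theta_e1_add_e2 τ e2).trans ?_
    simp [e2]
  have h₁₂ : translEnd (e1 + e2) (Theta τ (e1 + e2)) = Theta τ (e1 + e2) := by
    refine (transl_Theta_e1_add_e2 τ _).trans ?_
    simp [e1, e2, one_add_one_eq_two, mul_comm (π * I), ← mul_assoc]
  fin_cases i
  · change translEnd (e1 + e2) (Theta τ e1 + Theta τ e2) = (-1 : ℂ) • (Theta τ e1 + Theta τ e2)
    rw [map_add, h₁, h₂, neg_one_smul, neg_add]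
  · change translEnd (e1 + e2) (Theta τ 0 + Theta τ (e1 + e2)) =
      (1 : ℂ) • (Theta τ 0 + Theta τ (e1 + e2))
    rw [map_add, h₀, h₁₂, one_smul]
  · change translEnd (e1 + e2) (Theta τ 0 - Theta τ (e1 + e2)) =
      (1 : ℂ) • (Theta τ 0 - Theta τ (e1 + e2))
    rw [map_sub, h₀, h₁₂, one_smul]

theorem translTauEnd_eigenfun (τ : ℂ) (i : Fin 3) :
    translTauEnd τ (e1 + e2) (eigenfun τ i) = (![1, 1, -1] i : ℂ) • eigenfun τ i := by
  have hΘ (μ : V) : translTauEnd τ (e1 + e2) (Theta τ μ) = Theta τ (μ + (e1 + e2)) :=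
    translTau_Theta τ _ μ
  have h₁ : Theta τ (e1 + (e1 + e2)) = Theta τ e2 := by
    rw [← Theta_add_of_mem_corootLattice τ e2 two_smul_e1_mem_corootLattice, two_smul]
    abel_nf
  have h₂ : Theta τ (e2 + (e1 + e2)) = Theta τ e1 := by
    rw [← Theta_add_of_mem_corootLattice τ e1 two_smul_e2_mem_corootLattice, two_smul]
    abel_nf
  have h₁₂ : Theta τ (e1 + e2 + (e1 + e2)) = Theta τ 0 := by
    rw [← Theta_add_of_mem_corootLattice τ 0
      (add_mem two_smul_e1_mem_corootLattice two_smul_e2_mem_corootLattice), two_smul, two_smul]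
    abel_nf
  fin_cases i
  · change translTauEnd τ (e1 + e2) (Theta τ e1 + Theta τ e2) = (1 : ℂ) • (Theta τ e1 + Theta τ e2)
    rw [map_add, hΘ, hΘ, h₁, h₂, one_smul, add_comm]
  · change translTauEnd τ (e1 + e2) (Theta τ 0 + Theta τ (e1 + e2)) =
      (1 : ℂ) • (Theta τ 0 + Theta τ (e1 + e2))
    rw [map_add, hΘ, hΘ, h₁₂, zero_add, one_smul, add_comm]
  · change translTauEnd τ (e1 + e2) (Theta τ 0 - Theta τ (e1 + e2)) =
      (-1 : ℂ) • (Theta τ 0 - Theta τ (e1 + e2))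
    rw [map_sub, hΘ, hΘ, h₁₂, zero_add, neg_one_smul, neg_sub]

theorem linearIndependent_eigenfun (hτ : 0 < τ.im) : LinearIndependent ℂ (eigenfun τ) := by
  have hinj : Function.Injective (![1, 3, -1] : Fin 3 → ℂ) := by
    intro i j
    fin_cases i <;> fin_cases j <;> norm_num
  refine Module.End.eigenvectors_linearIndependent'
    (translEnd (e1 + e2) + (2 : ℂ) • translTauEnd τ (e1 + e2)) _ hinj _ fun i =>
      ⟨Module.End.mem_eigenspace_iff.mpr ?_, eigenfun_ne_zero hτ i⟩
  rw [LinearMap.add_apply, LinearMap.smul_apply, translEnd_eigenfun, translTauEnd_eigenfun,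
    smul_smul, ← add_smul]
  congr 1
  fin_cases i <;> norm_num

end LinearIndependence

section DifferenceOperators

theorem e1_ne_neg_e1 : e1 ≠ -e1 := fun h => by
  have := congrFun h 0
  norm_num [e1] at this

theorem e2_ne_neg_e2 : e2 ≠ -e2 := fun h => by
  have := congrFun h 1
  norm_num [e2] at this

theorem disjoint_pair_e1_pair_e2 : Disjoint ({e1, -e1} : Finset V) {e2, -e2} := by
  have h₁ : ∀ p ∈ ({e1, -e1} : Finset V), p 1 = 0 := by simp [e1]
  have h₂ : ∀ p ∈ ({e2, -e2} : Finset V), p 1 ≠ 0 := by simp [e2]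
  exact Finset.disjoint_left.mpr fun p hp hp' => h₂ p hp' (h₁ p hp)

theorem P1_eq_union : P1 = {e1, -e1} ∪ {e2, -e2} := by
  rw [P1, Finset.insert_union, Finset.singleton_union]

theorem filter_P1_of_mem_pair_e1 {p : V} (hp : p ∈ ({e1, -e1} : Finset V)) :
    {q ∈ P1 | q ≠ p ∧ q ≠ -p} = ({e2, -e2} : Finset V) := by
  have hd := disjoint_pair_e1_pair_e2
  rw [← Finset.union_sdiff_cancel_left hd, ← P1_eq_union]
  ext q
  grind

theorem filter_P1_of_mem_pair_e2 {p : V} (hp : p ∈ ({e2, -e2} : Finset V)) :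
    {q ∈ P1 | q ≠ p ∧ q ≠ -p} = ({e1, -e1} : Finset V) := by
  have hd := disjoint_pair_e1_pair_e2
  rw [← Finset.union_sdiff_cancel_right hd, ← P1_eq_union]
  ext q
  grind

theorem M1_eq_sum_add_sum (τ h : ℂ) (f : V → ℂ) (x : V) :
    M1 τ h f x =
      ∑ p ∈ ({e1, -e1} : Finset V), (∏ q ∈ ({e2, -e2} : Finset V),
        theta1 τ (form x (p + q) - h) / theta1 τ (form x (p + q))) *
          transl (h • (2 : ℂ) • p) f x +
      ∑ p ∈ ({e2, -e2} : Finset V), (∏ q ∈ ({e1, -e1} : Finset V),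
        theta1 τ (form x (p + q) - h) / theta1 τ (form x (p + q))) *
          transl (h • (2 : ℂ) • p) f x := by
  have hsum : M1 τ h f x = ∑ p ∈ {e1, -e1} ∪ {e2, -e2}, (∏ q ∈ P1 with q ≠ p ∧ q ≠ -p,
      theta1 τ (form x (p + q) - h) / theta1 τ (form x (p + q))) *
        transl (h • (2 : ℂ) • p) f x := Finset.sum_congr P1_eq_union fun _ _ => rfl
  rw [hsum, Finset.sum_union disjoint_pair_e1_pair_e2]
  congr 1
  · exact Finset.sum_congr rfl fun p hp => by rw [filter_P1_of_mem_pair_e1 hp]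
  · exact Finset.sum_congr rfl fun p hp => by rw [filter_P1_of_mem_pair_e2 hp]

theorem transl_smul_two_smul_e1_tensor (a : ℂ) (g k : ℂ → ℂ) (x : V) :
    transl (a • (2 : ℂ) • e1) (tensor g k) x =
      g (form x (e1 + e2) + a) * k (form x (e1 - e2) + a) := by
  rw [transl_tensor, form_e1_add_e2 (a • _), form_e1_sub_e2 (a • _)]
  simp [e1]

theorem transl_smul_two_smul_e2_tensor (a : ℂ) (g k : ℂ → ℂ) (x : V) :
    transl (a • (2 : ℂ) • e2) (tensor g k) x =
      g (form x (e1 + e2) + a) * k (form x (e1 - e2) - a) := by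
  rw [transl_tensor, form_e1_add_e2 (a • _), form_e1_sub_e2 (a • _)]
  simp [e2, neg_div, ← sub_eq_add_neg]

theorem transl_transl_tensor (a b : ℂ) (g k : ℂ → ℂ) (x : V) :
    transl (a • (2 : ℂ) • e1) (transl (b • (2 : ℂ) • e2) (tensor g k)) x =
      g (form x (e1 + e2) + (a + b)) * k (form x (e1 - e2) + (a - b)) := by
  rw [transl, transl_smul_two_smul_e2_tensor, form_add_left, form_add_left, form_e1_add_e2 (a • _),
    form_e1_sub_e2 (a • _)]
  simp [e1, add_assoc, add_sub_assoc]

theorem theta1_neg_sub (τ u h : ℂ) : theta1 τ (-u - h) = -theta1 τ (u + h) := by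
  rw [← neg_add', theta1_neg]

theorem theta1_neg_add (τ u h : ℂ) : theta1 τ (-u + h) = -theta1 τ (u - h) := by
  rw [neg_add_eq_sub, ← neg_sub, theta1_neg]

theorem M1_tensor (τ h : ℂ) (g k : ℂ → ℂ) (x : V) :
    M1 τ h (tensor g k) x = tensor (rankOneOp τ h g) (rankOneOp τ h k) x := by
  have hstep (b : V) : h • (2 : ℂ) • -b = -h • (2 : ℂ) • b := by module
  simp only [M1_eq_sum_add_sum, Finset.sum_pair e1_ne_neg_e1, Finset.sum_pair e2_ne_neg_e2,
    Finset.prod_pair e1_ne_neg_e1, Finset.prod_pair e2_ne_neg_e2, add_comm e2, add_comm (-e2),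
    ← sub_eq_add_neg e1 e2, form_neg_e1_add_e2, form_neg_e1_add_neg_e2, theta1_neg_sub, theta1_neg,
    neg_div_neg_eq, hstep, transl_smul_two_smul_e1_tensor, transl_smul_two_smul_e2_tensor,
    sub_neg_eq_add, ← sub_eq_add_neg _ h, tensor, rankOneOp]
  ring

theorem M2_tensor {τ h : ℂ} (g k : ℂ → ℂ) {x : V} (hu : theta1 τ (form x (e1 + e2)) ≠ 0)
    (hv : theta1 τ (form x (e1 - e2)) ≠ 0) :
    M2 τ h (tensor g k) x = tensor (rankOneOp τ h (rankOneOp τ h g)) k x +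
      tensor g (rankOneOp τ h (rankOneOp τ h k)) x := by
  have hstep (b : V) : h • (2 : ℂ) • -b = -h • (2 : ℂ) • b := by module
  have hadd : -h + -h = -(2 * h) := by ring
  have hsub : -h - h = -(2 * h) := by ring
  simp only [M2, Finset.sum_pair e1_ne_neg_e1, Finset.sum_pair e2_ne_neg_e2,
    ← sub_eq_add_neg e1 e2, form_neg_e1_add_e2, form_neg_e1_add_neg_e2, theta1_neg,
    theta1_neg_sub, theta1_neg_add, neg_div_neg_eq, neg_mul_neg, hstep, transl_transl_tensor,
    hadd, hsub, sub_neg_eq_add, sub_self, ← two_mul, add_neg_cancel, neg_add_cancel, add_zero,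
    tensor]
  simp only [← sub_eq_add_neg, rankOneOp_rankOneOp _ hu, rankOneOp_rankOneOp _ hv]
  ring

variable {τ h : ℂ} {i : Fin 3} {x : V}

theorem M1_eigenfun (hτ : 0 < τ.im) (h₁ : theta1 τ h ≠ 0) (hi : evenTheta τ i h ≠ 0)
    (hx : x ∈ regular1 τ) :
    M1 τ h (eigenfun τ i) x = eigenval1 τ h i * eigenfun τ i x := by
  have hne {q : V} (hq : q ∈ ({e2, -e2} : Finset V)) : theta1 τ (form x (e1 + q)) ≠ 0 := by
    rw [← filter_P1_of_mem_pair_e1 (Finset.mem_insert_self e1 {-e1}), Finset.mem_filter] at hq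
    exact hx e1 (Finset.mem_insert_self _ _) q hq.1 hq.2.1 hq.2.2
  have hu : theta1 τ (form x (e1 + e2)) ≠ 0 := hne (by simp)
  have hv : theta1 τ (form x (e1 - e2)) ≠ 0 := sub_eq_add_neg e1 e2 ▸ hne (by simp)
  rw [eigenfun_eq_tensor hτ, M1_tensor, tensor, rankOneOp_evenTheta hτ h₁ hi hu,
    rankOneOp_evenTheta hτ h₁ hi hv, mul_mul_mul_comm, ← sq]
  rfl

theorem M2_eigenfun (hτ : 0 < τ.im) (h₁ : theta1 τ h ≠ 0) (hi : evenTheta τ i h ≠ 0)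
    (hx : x ∈ regular2 τ h) :
    M2 τ h (eigenfun τ i) x = eigenval2 τ h i * eigenfun τ i x := by
  obtain ⟨hu, hu₁⟩ := hx e1 (by simp) e2 (by simp)
  obtain ⟨hv, hv₁⟩ := hx e1 (by simp) (-e2) (by simp)
  obtain ⟨-, hu₂⟩ := hx (-e1) (by simp) (-e2) (by simp)
  obtain ⟨-, hv₂⟩ := hx (-e1) (by simp) e2 (by simp)
  rw [← sub_eq_add_neg] at hv hv₁
  rw [form_neg_e1_add_neg_e2, theta1_neg_add, neg_ne_zero] at hu₂
  rw [form_neg_e1_add_e2, theta1_neg_add, neg_ne_zero] at hv₂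
  rw [eigenfun_eq_tensor hτ, M2_tensor _ _ hu hv, tensor, tensor,
    rankOneOp_rankOneOp_evenTheta hτ h₁ hi hu hu₁ hu₂,
    rankOneOp_rankOneOp_evenTheta hτ h₁ hi hv hv₁ hv₂, tensor, eigenval2]
  change _ = 2 * rankOneEigenval τ h i ^ 2 * _
  ring

end DifferenceOperators

end C2

theorem theorem3 (τ : ℂ) (hτ : 0 < τ.im) (h : ℂ) :
    (∀ i : Fin 3, C2.eigenfun τ i ∈ C2.Th1W τ) ∧
    LinearIndependent ℂ (C2.eigenfun τ) ∧
    ∀ i : Fin 3,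
      C2.eigenfun τ i ≠ 0 ∧
      (C2.theta1 τ h ≠ 0 → C2.evenTheta τ i h ≠ 0 →
        (∀ x ∈ C2.regular1 τ,
          C2.M1 τ h (C2.eigenfun τ i) x = C2.eigenval1 τ h i * C2.eigenfun τ i x) ∧
        (∀ x ∈ C2.regular2 τ h,
          C2.M2 τ h (C2.eigenfun τ i) x = C2.eigenval2 τ h i * C2.eigenfun τ i x)) :=
  ⟨C2.eigenfun_mem_Th1W hτ, C2.linearIndependent_eigenfun hτ, fun i =>
    ⟨C2.eigenfun_ne_zero hτ i, fun h₁ hi =>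
      ⟨fun _ hx => C2.M1_eigenfun hτ h₁ hi hx, fun _ hx => C2.M2_eigenfun hτ h₁ hi hx⟩⟩⟩
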